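/- Let $\mathcal L$ be a packing LP: maximize $\sum_{j=1}^n c_jx_j$ subject to $\sum_{j=1}^n a_{ij}x_j\le b_i$ for $i\in[m]$ and $0\le x_j\le 1$ for $j\in[n]$, where $m,n\ge 1$, $A=(a_{ij})\in[0,1]^{m\times n}$, $b\in\mathbb R_{\ge 0}^m$, $c\in\mathbb R_{\ge 0}^n$. Write $\phi\in\mathbb R^m_{\ge0}$ and $\psi\in\mathbb R^n_{\ge 0}$ for dual variables of the two kinds of constraints; they are dual feasible if $\sum_i a_{ij}\phi_i+\psi_j\ge c_j$ for all $j$. For $\alpha_d\ge 1$, a $(1,\alpha_d)$-approximation algorithm $\mathcal A$ for packing LPs is a (possibly randomized) algorithm which on every packing LP outputs a feasible $x$ and dual feasible $(\phi,\psi)$ such that (i) if $x_j>0$ then $\sum_i a_{ij}\phi_i+\psi_j=c_j$; (ii) if $\phi_i>0$ then $b_i/\alpha_d\le\sum_j a_{ij}x_j\le b_i$, and if $\psi_j>0$ then $1/\alpha_d\le x_j\le 1$. Let its runtime on LPs with $n$ variables and $m$ constraints be at most $f(n,m)$. For parameters $\varepsilon_s\in(0,1]$ and $\varepsilon$, the acceleration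 algorithm does the following: (1) it selects a uniformly random set $S\subseteq[n]$ of $s=\lceil\varepsilon_s n\rceil$ variables; (2) it runs $\mathcal A$ on the sample LP: maximize $\sum_{j\in S}c_jx_j$ subject to $\sum_{j\in S}a_{ij}x_j\le\frac{(1-\varepsilon)\varepsilon_s}{\alpha_d}b_i$ for $i\in[m]$ and $0\le x_j\le1$ for $j\in S$, obtaining dual prices $\phi\in\mathbb R^m$ of the rows; (3) for every $j\in[n]$ it sets $\hat x_j=1$ if $\sum_i a_{ij}\phi_i<c_j$ and $\hat x_j=0$ otherwise, and it returns $\hat x$. Theorem. Let $B=\min_i b_i>0$, let $\varepsilon_s n$ be an integer, let $\mathcal A$ be a $(1,\alpha_d)$-approximation algorithm for packing LPs with runtime $f$, and suppose that $$\varepsilon_f\ge 3\sqrt{\frac{6(m+2)\log n}{\varepsilon_sB}}.$$ Assume that for every $\phi\in\mathbb R^m_{\ge0}$ at most $m$ indices $j\in[n]$ satisfy $\sum_i a_{ij}\phi_i=c_j$, and that $2\alpha_d^4+\alpha_d^2\,\varepsilon_f/3\le 3$ (so $\alpha_d$ is close to one). Then the acceleration algorithm with parameters $\varepsilon_s$ and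 $\varepsilon=\varepsilon_f/3$ takes at most $f(\varepsilon_sn,m)+C\,mn$ steps for a universal constant $C$, that is, time $f(\varepsilon_sn,m)+O(n)$ when the number $m$ of constraints is regarded as fixed. With probability at least $1-\frac1n$ its output is a feasible solution of $\mathcal L$ whose value is at least $\frac{1-\varepsilon_f}{\alpha_d^2}$ times the optimal value of $\mathcal L$. Time is counted in unit-cost steps (real arithmetic, comparisons, memory accesses, and draws of a uniform element of $\{0,\dots,k\}$), plus the steps of $\mathcal A$. -/

import Mathlib

open scoped BigOperators ENNReal

noncomputable section

namespace PackingAccel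

/-! ## Packing linear programs -/

/-- Data of the linear program `max ∑ j, c j * x j` subject to `∑ j, a i j * x j ≤ b i` for
`i : Fin m` and `0 ≤ x j ≤ 1` for `j : Fin n`. -/
structure LP (m n : ℕ) where
  a : Fin m → Fin n → ℝ
  b : Fin m → ℝ
  c : Fin n → ℝ

/-- A primal vector `x` together with dual prices `phi` for the rows and `psi` for the upper
bounds `x j ≤ 1`. -/
structure PrimalDual (m n : ℕ) where
  x : Fin n → ℝ
  phi : Fin m → ℝ
  psi : Fin n → ℝ

namespace LP

variable {m n : ℕ}

/-- The program is a packing LP: `A ∈ [0,1]^(m×n)`, `b ≥ 0`, `c ≥ 0`. -/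
structure IsPacking (L : LP m n) : Prop where
  a_nonneg : ∀ i j, 0 ≤ L.a i j
  a_le_one : ∀ i j, L.a i j ≤ 1
  b_nonneg : ∀ i, 0 ≤ L.b i
  c_nonneg : ∀ j, 0 ≤ L.c j

/-- The objective value of `x`. -/
def value (L : LP m n) (x : Fin n → ℝ) : ℝ := ∑ j, L.c j * x j

/-- Primal feasibility. -/
structure Feasible (L : LP m n) (x : Fin n → ℝ) : Prop where
  nonneg : ∀ j, 0 ≤ x j
  le_one : ∀ j, x j ≤ 1
  row_le : ∀ i, ∑ j, L.a i j * x j ≤ L.b i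

/-- Feasibility for the dual `min ∑ i, b i * phi i + ∑ j, psi j` subject to
`∑ i, a i j * phi i + psi j ≥ c j`, `phi ≥ 0`, `psi ≥ 0`. -/
structure DualFeasible (L : LP m n) (phi : Fin m → ℝ) (psi : Fin n → ℝ) : Prop where
  phi_nonneg : ∀ i, 0 ≤ phi i
  psi_nonneg : ∀ j, 0 ≤ psi j
  col_ge : ∀ j, L.c j ≤ ∑ i, L.a i j * phi i + psi j

/-- A feasible primal-dual pair satisfying `αp`-approximate primal and `αd`-approximate dual
complementary slackness. The dual condition is imposed on both kinds of primal constraints, the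
rows (prices `phi`) and the upper bounds `x j ≤ 1` (prices `psi`). -/
structure ApproxSlack (αp αd : ℝ) (L : LP m n) (y : PrimalDual m n) : Prop where
  primal_feasible : L.Feasible y.x
  dual_feasible : L.DualFeasible y.phi y.psi
  primal_slack : ∀ j, 0 < y.x j →
    L.c j ≤ ∑ i, L.a i j * y.phi i + y.psi j ∧
      ∑ i, L.a i j * y.phi i + y.psi j ≤ αp * L.c j
  dual_slack_row : ∀ i, 0 < y.phi i →
    L.b i / αd ≤ ∑ j, L.a i j * y.x j ∧ ∑ j, L.a i j * y.x j ≤ L.b i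
  dual_slack_box : ∀ j, 0 < y.psi j → 1 / αd ≤ y.x j ∧ y.x j ≤ 1

/-- `x` is feasible and its value is at least `ρ` times that of every feasible vector (for
`ρ ≥ 0`: at least `ρ` times the optimal value). -/
def IsApproxSolution (L : LP m n) (ρ : ℝ) (x : Fin n → ℝ) : Prop :=
  L.Feasible x ∧ ∀ z, L.Feasible z → ρ * L.value z ≤ L.value x

/-- `B = min_i b i` (when `m > 0`). -/
def minRhs (L : LP m n) : ℝ := ⨅ i, L.b i

/-- For all row prices `phi ≥ 0`, at most `m` columns satisfy `∑ i, a i j * phi i = c j`. -/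
def GeneralPosition (L : LP m n) : Prop :=
  ∀ phi : Fin m → ℝ, (∀ i, 0 ≤ phi i) → {j | ∑ i, L.a i j * phi i = L.c j}.ncard ≤ m

end LP

/-! ## Randomized computations with a step count -/

/-- A randomized computation with result in `α`, given by the joint law of its result and of the
number of elementary steps it performs. -/
structure RComp (α : Type) where
  law : PMF (α × ℕ)

namespace RComp

variable {α β : Type}

/-- Return a value, without performing a step. -/
protected def pure (a : α) : RComp α := ⟨PMF.pure (a, 0)⟩

/-- Run `p`, then run `q` (with fresh randomness) on its result; the steps add up. -/
protected def bind (p : RComp α) (q : α → RComp β) : RComp β :=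
  ⟨p.law.bind fun r => (q r.1).law.map fun r' => (r'.1, r.2 + r'.2)⟩

instance : Monad RComp where
  pure := RComp.pure
  bind := RComp.bind

/-- One elementary step with result `a`. It is used below only for one arithmetic operation, one
comparison, one conditional assignment, or one read or write of a memory cell. -/
def step (a : α) : RComp α := ⟨PMF.pure (a, 1)⟩

/-- One elementary step that draws a uniformly random element of `{0, …, k}`. -/
def randStep (k : ℕ) : RComp (Fin (k + 1)) :=
  ⟨(PMF.uniformOfFintype (Fin (k + 1))).map fun r => (r, 1)⟩

/-- Fill an array entry by entry, with one step for each write in addition to the steps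
that compute the entry. -/
def fill : {k : ℕ} → (Fin k → RComp α) → RComp (Fin k → α)
  | 0, _ => pure Fin.elim0
  | _ + 1, entry => do
    let x ← entry 0
    let x ← step x
    let rest ← fill fun i => entry i.succ
    pure (Fin.cons x rest)

/-- The probability that the result satisfies `E`. -/
def prob (p : RComp α) (E : α → Prop) : ℝ≥0∞ := p.law.toOuterMeasure {r | E r.1}

/-- The computation performs at most `t` steps, whatever the random choices. -/
def StepsLE (p : RComp α) (t : ℕ) : Prop := ∀ r ∈ p.law.support, r.2 ≤ t

end RComp

/-! ## LP solvers -/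

/-- A (possibly randomized) black-box LP solver: on each LP it returns a primal and a dual vector
and it performs some number of steps. -/
abbrev Solver := ∀ {m n : ℕ}, LP m n → RComp (PrimalDual m n)

/-- An `(αp, αd)`-approximation algorithm for packing LPs. -/
def IsApproxAlgorithm (αp αd : ℝ) (𝒜 : Solver) : Prop :=
  ∀ (m n : ℕ) (L : LP m n), L.IsPacking →
    ∀ r ∈ (𝒜 L).law.support, L.ApproxSlack αp αd r.1

/-- On packing LPs with `n` variables and `m` constraints, the runtime is at most `f n m`. -/
def HasRuntime (𝒜 : Solver) (f : ℕ → ℕ → ℕ) : Prop :=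
  ∀ (m n : ℕ) (L : LP m n), L.IsPacking → (𝒜 L).StepsLE (f n m)

/-! ## The acceleration algorithm -/

open PackingAccel.RComp

variable {m n : ℕ}

/-- Selection sampling: scan the list, and select each entry with probability
(number still to be selected) / (number of entries still to be scanned, this one included).
For `s ≤ l.length` and `l` without repetitions, the result is a uniformly random `s`-element
subset of the entries of `l` (`selectionSample_uniform`), listed in the order of `l`. -/
def selectionSample : List (Fin n) → ℕ → RComp (List (Fin n))
  | [], _ => pure []
  | j :: l, s => do
    let k ← step l.length
    let r ← randStep k
    let chosen ← step (decide (r.val < s))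
    if chosen then
      let s' ← step (s - 1)
      let S ← selectionSample l s'
      step (j :: S)
    else
      selectionSample l s

/-- Write down the sample LP: the columns `S.get k`, with right-hand side `(1-ε) εs / α * b i`. -/
def buildSampleLP (α εs ε : ℝ) (L : LP m n) (S : List (Fin n)) : RComp (LP m S.length) := do
  let a ← fill fun i => fill fun k => do
    let j ← step (S.get k)
    step (L.a i j)
  let u ← step (1 - ε)
  let u ← step (u * εs)
  let u ← step (u / α)
  let b ← fill fun i => do
    let v ← step (L.b i)
    step (u * v)
  let c ← fill fun k => do
    let j ← step (S.get k)
    step (L.c j)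
  pure ⟨a, b, c⟩

/-- Compute `∑ i, a i j * phi i` by a loop over the rows. -/
def columnPrice (L : LP m n) (phi : Fin m → ℝ) (j : Fin n) : RComp ℝ :=
  (List.finRange m).foldlM (init := (0 : ℝ)) fun acc i => do
    let u ← step (L.a i j)
    let v ← step (phi i)
    let w ← step (u * v)
    step (acc + w)

/-- The thresholding rule: `1` if `∑ i, a i j * phi i < c j`, and `0` otherwise. -/
def threshold (L : LP m n) (phi : Fin m → ℝ) (j : Fin n) : RComp ℝ := do
  let p ← columnPrice L phi j
  let v ← step (L.c j)
  step (if p < v then 1 else 0)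

/-- The core acceleration algorithm with solver `𝒜`, slackness parameter `α`, sampling parameter
`εs` and feasibility parameter `ε`. -/
def accelerate (𝒜 : Solver) (α εs ε : ℝ) (L : LP m n) : RComp (Fin n → ℝ) := do
  let t ← step (εs * n)
  let s ← step ⌈t⌉₊
  let S ← selectionSample (List.finRange n) s
  let L' ← buildSampleLP α εs ε L S
  let y ← 𝒜 L'
  fill fun j => threshold L y.phi j

/-! ## Selection sampling is uniform -/

theorem RComp.prob_bind {α β : Type} (p : RComp α) (q : α → RComp β) (E : β → Prop) :
    (p >>= q).prob E = ∑' r, p.law r * (q r.1).prob E := by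
  simp only [RComp.prob, bind, RComp.bind, PMF.toOuterMeasure_bind_apply,
    PMF.toOuterMeasure_map_apply]
  rfl

theorem prob_step_bind {α β : Type} (a : α) (q : α → RComp β) (E : β → Prop) :
    (RComp.step a >>= q).prob E = (q a).prob E := by
  rw [RComp.prob_bind, tsum_eq_single (a, 1)]
  · simp [RComp.step]
  · intro r hr
    simp [RComp.step, hr]

theorem prob_rand_bind {β : Type} (k : ℕ) (q : Fin (k + 1) → RComp β) (E : β → Prop) :
    (RComp.randStep k >>= q).prob E = ∑ i, ((k + 1 : ℕ) : ℝ≥0∞)⁻¹ * (q i).prob E := by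
  have : (RComp.randStep k >>= q).prob E =
      ((PMF.uniformOfFintype (Fin (k+1))).bind fun i => ((q i).law)).toOuterMeasure {r | E r.1} := by
    simp only [RComp.prob, bind, RComp.bind, RComp.randStep, PMF.bind_map, Function.comp_def,
      PMF.toOuterMeasure_bind_apply, PMF.toOuterMeasure_map_apply]
    rfl
  rw [this, PMF.toOuterMeasure_bind_apply, tsum_fintype]
  simp [RComp.prob]


theorem prob_bind_step {α β : Type} (p : RComp α) (g : α → β) (E : β → Prop) :
    (p >>= fun a => RComp.step (g a)).prob E = p.prob fun a => E (g a) := by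
  have h : (p >>= fun a => RComp.step (g a)).law = p.law.map fun r => (g r.1, r.2 + 1) := by
    simp only [bind, RComp.bind, RComp.step, PMF.pure_map]
    rfl
  simp only [RComp.prob, h, PMF.toOuterMeasure_map_apply]
  rfl

theorem prob_false {α : Type} (p : RComp α) (E : α → Prop) (h : ∀ a, ¬ E a) : p.prob E = 0 := by
  have : {r : α × ℕ | E r.1} = ∅ := by ext r; simp [h]
  simp [RComp.prob, this]

theorem prob_congr {α : Type} (p : RComp α) {E F : α → Prop} (h : ∀ a, E a ↔ F a) :
    p.prob E = p.prob F := by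
  rw [show E = F from funext fun a => propext (h a)]

theorem selectionSample_prob_mem (l : List (Fin n)) (j : Fin n) (hj : j ∉ l) (s : ℕ) :
    (selectionSample l s).prob (fun S => j ∈ S) = 0 := by
  induction l generalizing s with
  | nil => simp [selectionSample, RComp.prob, pure, RComp.pure]
  | cons i l ih =>
    simp only [List.mem_cons, not_or] at hj
    rw [selectionSample, prob_step_bind, prob_rand_bind]
    refine Finset.sum_eq_zero fun r _ => ?_
    rw [prob_step_bind]
    split_ifs
    · rw [prob_step_bind, prob_bind_step, prob_congr _ (F := fun S => j ∈ S), ih hj.2, mul_zero]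
      simp [hj.1]
    · rw [ih hj.2, mul_zero]

theorem prob_mono {α : Type} (p : RComp α) {E F : α → Prop} (h : ∀ a, E a → F a) :
    p.prob E ≤ p.prob F :=
  p.law.toOuterMeasure.mono fun _ hr => h _ hr

theorem sum_lt (N s : ℕ) (hs : s ≤ N + 1) (x : ℝ≥0∞) :
    ∑ i : Fin (N + 1), (if i.val < s then x else 0) = s * x := by
  rw [Fin.sum_univ_eq_sum_range (fun i => if i < s then x else 0) (N + 1), ← Finset.sum_filter]
  have : (Finset.range (N + 1)).filter (· < s) = Finset.range s := by
    ext i; simp; omega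
  simp [this]

theorem sum_ge (N s : ℕ) (x : ℝ≥0∞) :
    ∑ i : Fin (N + 1), (if i.val < s then 0 else x) = (N + 1 - s : ℕ) * x := by
  rw [Fin.sum_univ_eq_sum_range (fun i => if i < s then 0 else x) (N + 1)]
  simp only [← ite_not (_ < s)]
  rw [← Finset.sum_filter]
  have : (Finset.range (N + 1)).filter (fun i => ¬ i < s) = Finset.Ico s (N + 1) := by
    ext i; simp; omega
  rw [this]
  simp

theorem inv_arith (a b c d : ℕ) (ha : 0 < a) (hb : 0 < b) (h : a * b = d * c) :
    (c : ℝ≥0∞) * ((a : ℝ≥0∞)⁻¹ * (b : ℝ≥0∞)⁻¹) = (d : ℝ≥0∞)⁻¹ := by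
  rw [← ENNReal.mul_inv (by simp) (by simp)]
  have h' : (a : ℝ≥0∞) * b = d * c := by exact_mod_cast h
  have hc : 0 < c := by
    rcases Nat.eq_zero_or_pos c with rfl | hc
    · have := Nat.mul_pos ha hb; omega
    · exact hc
  rw [h', ENNReal.mul_inv (by simp) (by simp), mul_comm (_⁻¹), ← mul_assoc,
    ENNReal.mul_inv_cancel (by exact_mod_cast hc.ne') (by simp), one_mul]

/-- Every `s`-element subset `T` of the entries of `l` is selected with probability
`1 / (l.length choose s)`, and it is listed in the order of `l`. -/
theorem selectionSample_uniform (l : List (Fin n)) (hl : l.Nodup) (s : ℕ) (T : Finset (Fin n))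
    (hT : T ⊆ l.toFinset) (hc : T.card = s) :
    (selectionSample l s).prob (fun S => S = l.filter (· ∈ T)) =
      ((l.length.choose s : ℕ) : ℝ≥0∞)⁻¹ := by
  induction l generalizing s T with
  | nil =>
    have : T = ∅ := by simpa using hT
    subst this
    simp at hc
    subst hc
    simp [selectionSample, RComp.prob, pure, RComp.pure]
  | cons j l ih =>
    have hj : j ∉ l := (List.nodup_cons.1 hl).1
    have hl' := (List.nodup_cons.1 hl).2
    have hlen : l.toFinset.card = l.length := List.toFinset_card_of_nodup hl'
    rw [selectionSample, prob_step_bind, prob_rand_bind]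
    simp only [prob_step_bind]
    by_cases hjT : j ∈ T
    · have hspos : 0 < s := hc ▸ Finset.card_pos.2 ⟨j, hjT⟩
      have hsub : T.erase j ⊆ l.toFinset := by
        intro x hx
        have := hT (Finset.mem_of_mem_erase hx)
        simp at this hx
        simp; tauto
      have hsl : s - 1 ≤ l.length := by
        rw [← hlen, ← hc, ← Finset.card_erase_of_mem hjT]
        exact Finset.card_le_card hsub
      have key := ih hl' (s - 1) (T.erase j) hsub (by rw [Finset.card_erase_of_mem hjT, hc])
      have hfe : l.filter (· ∈ T.erase j) = l.filter (· ∈ T) := by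
        apply List.filter_congr
        intro x hx
        have : x ≠ j := fun h => hj (h ▸ hx)
        simp [this]
      rw [hfe] at key
      have hf : (j :: l).filter (· ∈ T) = j :: l.filter (· ∈ T) := by simp [hjT]
      have hmain : ∀ i : Fin (l.length + 1),
          ((l.length + 1 : ℕ) : ℝ≥0∞)⁻¹ *
            (if decide (i.val < s) = true then do
                let s' ← RComp.step (s - 1)
                let S ← selectionSample l s'
                RComp.step (j :: S)
              else selectionSample l s).prob (fun S => S = (j :: l).filter (· ∈ T)) =
          if i.val < s then ((l.length + 1 : ℕ) : ℝ≥0∞)⁻¹ *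
            ((l.length.choose (s - 1) : ℕ) : ℝ≥0∞)⁻¹ else 0 := by
        intro i
        by_cases hi : i.val < s
        · simp only [hi, decide_true, if_true]
          rw [prob_step_bind, prob_bind_step, ← key]
          congr 1
          apply prob_congr
          intro S
          rw [hf]
          simp
        · simp only [hi, decide_false, if_false]
          rw [hf]
          have h0 := prob_mono (selectionSample l s)
            (E := fun S => S = j :: l.filter (· ∈ T)) (F := fun S => j ∈ S)
            (by rintro S rfl; simp)
          rw [selectionSample_prob_mem l j hj s] at h0
          simp [nonpos_iff_eq_zero.1 h0]
      rw [Finset.sum_congr rfl fun i _ => hmain i, sum_lt _ _ (by omega)]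
      refine inv_arith _ _ _ _ (by omega) (Nat.choose_pos hsl) ?_
      obtain ⟨s, rfl⟩ : ∃ t, s = t + 1 := ⟨s - 1, by omega⟩
      simpa using Nat.add_one_mul_choose_eq l.length s
    · have hsub : T ⊆ l.toFinset := by
        intro x hx
        have := hT hx
        simp at this
        rcases this with rfl | h
        · exact absurd hx hjT
        · simpa using h
      have hsl : s ≤ l.length := by
        rw [← hlen, ← hc]
        exact Finset.card_le_card hsub
      have key := ih hl' s T hsub hc
      have hf : (j :: l).filter (· ∈ T) = l.filter (· ∈ T) := by simp [hjT]
      have hmain : ∀ i : Fin (l.length + 1),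
          ((l.length + 1 : ℕ) : ℝ≥0∞)⁻¹ *
            (if decide (i.val < s) = true then do
                let s' ← RComp.step (s - 1)
                let S ← selectionSample l s'
                RComp.step (j :: S)
              else selectionSample l s).prob (fun S => S = (j :: l).filter (· ∈ T)) =
          if i.val < s then 0 else ((l.length + 1 : ℕ) : ℝ≥0∞)⁻¹ *
            ((l.length.choose s : ℕ) : ℝ≥0∞)⁻¹ := by
        intro i
        by_cases hi : i.val < s
        · simp only [hi, decide_true, if_true]
          rw [prob_step_bind, prob_bind_step, hf, prob_false, mul_zero]
          intro S h
          have : j ∈ l.filter (· ∈ T) := by rw [← h]; simp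
          exact hj (List.mem_of_mem_filter this)
        · simp only [hi, decide_false, if_false]
          rw [hf, ← key]
          simp
      rw [Finset.sum_congr rfl fun i _ => hmain i, sum_ge _ _]
      refine inv_arith _ _ _ _ (by omega) (Nat.choose_pos hsl) ?_
      simpa [mul_comm] using Nat.choose_mul_succ_eq l.length s

end PackingAccel

end

open PackingAccel

namespace PackingAccel

variable {m n : ℕ} {α β : Type}

/-! The output depends on the prices `phi` only through the set `L.cheap phi` of columns priced
below their objective coefficient. Approximate complementary slackness links this set to the
solver's sample solution `x`: a cheap column has positive `psi`, hence `x ≥ 1/α`, and a column with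
`x > 0` is cheap or a tie, of which there are at most `m`. So on the sample the cheap columns load
row `i` by at most `(1-ε) εs b i`, and by at least `(1-ε) εs b i / α² - m` if `phi i > 0`
(`sample_weight_le`, `le_sample_weight`).

These bounds must be transferred to all columns, although `phi` depends on the sample. For a fixed
set of columns, Chernoff bounds for sampling without replacement apply
(`selectionSample_lower_tail`, `selectionSample_upper_tail`). A union bound over all sets of the
form `L.cheap phi` suffices: they have VC dimension at most `m`, so there are at most `n^(m+1)` of
them (`card_patterns_le`). The total failure probability is at most `1/n` (`prob_goodSample`).

On a good sample no row is violated, and every row with positive price is filled to at least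
`(1-3ε)/α²` of its capacity. Pricing the rows by `phi` as in Lagrangian duality then yields the
approximation ratio (`mul_value_le_value_rounded`). -/

/-! ## Expectations -/

/-- The expectation of a nonnegative function of the result. -/
noncomputable def RComp.expect (p : RComp α) (g : α → ℝ≥0∞) : ℝ≥0∞ := ∑' r, p.law r * g r.1

theorem RComp.prob_eq_expect (p : RComp α) (E : α → Prop) :
    p.prob E = p.expect (Set.indicator {a | E a} 1) := by
  classical
  rw [RComp.prob, PMF.toOuterMeasure_apply, RComp.expect]
  refine tsum_congr fun r => ?_
  by_cases h : E r.1 <;> simp [Set.indicator, h]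

theorem RComp.expect_mono (p : RComp α) {g h : α → ℝ≥0∞} (H : ∀ a, g a ≤ h a) :
    p.expect g ≤ p.expect h :=
  ENNReal.tsum_le_tsum fun r => mul_le_mul_right (H r.1) _

theorem RComp.expect_const_mul (p : RComp α) (c : ℝ≥0∞) (g : α → ℝ≥0∞) :
    p.expect (fun a => c * g a) = c * p.expect g := by
  simp only [RComp.expect, ← ENNReal.tsum_mul_left]
  exact tsum_congr fun r => by ring

theorem RComp.expect_pure (a : α) (g : α → ℝ≥0∞) : (pure a : RComp α).expect g = g a := by
  classical
  rw [RComp.expect, tsum_eq_single (a, 0)]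
  · simp [pure, RComp.pure]
  · intro r hr
    simp [pure, RComp.pure, hr]

theorem RComp.expect_bind (p : RComp α) (q : α → RComp β) (g : β → ℝ≥0∞) :
    (p >>= q).expect g = p.expect fun a => (q a).expect g := by
  classical
  -- `g` ignores the step count, so adding the steps of the first computation does not change the
  -- sum.
  have hmap : ∀ (r : α × ℕ) (u : PMF (β × ℕ)),
      ∑' x, (u.map fun r' => (r'.1, r.2 + r'.2)) x * g x.1 = ∑' x, u x * g x.1 := by
    intro r u
    simp only [PMF.map_apply, ← ENNReal.tsum_mul_right]
    rw [ENNReal.tsum_comm]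
    refine tsum_congr fun x => ?_
    rw [tsum_eq_single (x.1, r.2 + x.2)]
    · simp
    · intro y hy
      simp [hy]
  simp only [RComp.expect, bind, RComp.bind, PMF.bind_apply, ← ENNReal.tsum_mul_right]
  rw [ENNReal.tsum_comm]
  refine tsum_congr fun r => ?_
  rw [← hmap r, ← ENNReal.tsum_mul_left]
  exact tsum_congr fun x => mul_assoc _ _ _

theorem RComp.expect_step (a : α) (g : α → ℝ≥0∞) : (RComp.step a).expect g = g a := by
  classical
  rw [RComp.expect, tsum_eq_single (a, 1)]
  · simp [RComp.step]
  · intro r hr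
    simp [RComp.step, hr]

theorem RComp.expect_randStep (k : ℕ) (g : Fin (k + 1) → ℝ≥0∞) :
    (RComp.randStep k).expect g = ((k + 1 : ℕ) : ℝ≥0∞)⁻¹ * ∑ i, g i := by
  classical
  simp only [RComp.expect, RComp.randStep, PMF.map_apply, ← ENNReal.tsum_mul_right]
  rw [ENNReal.tsum_comm, tsum_fintype, Finset.mul_sum]
  refine Finset.sum_congr rfl fun i _ => ?_
  rw [tsum_eq_single (i, 1)]
  · simp
  · intro y hy
    simp [hy]

theorem RComp.prob_add_prob_not (p : RComp α) (E : α → Prop) :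
    p.prob E + p.prob (fun a => ¬ E a) = 1 := by
  classical
  simp only [RComp.prob_eq_expect, RComp.expect]
  rw [← ENNReal.tsum_add, ← p.law.tsum_coe]
  refine tsum_congr fun r => ?_
  by_cases h : E r.1 <;> simp [Set.indicator, h]

theorem RComp.prob_exists_le {ι : Type*} (p : RComp α) (s : Finset ι) (E : ι → α → Prop) :
    p.prob (fun a => ∃ i ∈ s, E i a) ≤ ∑ i ∈ s, p.prob (E i) := by
  have : {r : α × ℕ | ∃ i ∈ s, E i r.1} = ⋃ i ∈ s, {r : α × ℕ | E i r.1} := by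
    ext r; simp
  rw [RComp.prob, this]
  exact MeasureTheory.measure_biUnion_finset_le _ _

theorem RComp.prob_or_le (p : RComp α) (E F : α → Prop) :
    p.prob (fun a => E a ∨ F a) ≤ p.prob E + p.prob F := by
  have h := MeasureTheory.measure_union_le (μ := p.law.toOuterMeasure)
    {r : α × ℕ | E r.1} {r : α × ℕ | F r.1}
  exact h

/-- Support of a sequential composition. -/
theorem RComp.mem_support_bind (p : RComp α) (q : α → RComp β) (r : β × ℕ) :
    r ∈ (p >>= q).law.support ↔
      ∃ u ∈ p.law.support, ∃ v ∈ (q u.1).law.support, r = (v.1, u.2 + v.2) := by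
  simp only [bind, RComp.bind, PMF.mem_support_bind_iff, PMF.mem_support_map_iff]
  constructor
  · rintro ⟨u, hu, v, hv, rfl⟩
    exact ⟨u, hu, v, hv, rfl⟩
  · rintro ⟨u, hu, v, hv, rfl⟩
    exact ⟨u, hu, v, hv, rfl⟩

/-- If `E` holds surely after every result of `p` satisfying `G`, then `E` is at least as likely
as `G`. -/
theorem RComp.prob_le_prob_bind (p : RComp α) (q : α → RComp β) (G : α → Prop) (E : β → Prop)
    (h : ∀ u ∈ p.law.support, G u.1 → ∀ v ∈ (q u.1).law.support, E v.1) :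
    p.prob G ≤ (p >>= q).prob E := by
  classical
  rw [RComp.prob_bind, RComp.prob_eq_expect, RComp.expect]
  refine ENNReal.tsum_le_tsum fun u => ?_
  by_cases hu : p.law u = 0
  · simp [hu]
  · by_cases hG : G u.1
    · have : (q u.1).prob E = 1 := by
        rw [RComp.prob, PMF.toOuterMeasure_apply_eq_one_iff]
        exact fun v hv => h u ((PMF.mem_support_iff _ _).2 hu) hG v hv
      simp [Set.indicator, hG, this]
    · simp [Set.indicator, hG]

/-! ## Moment generating function of a sample without replacement -/

/-- By convexity, the graph of `x ^ (s + 1)` lies above its tangent line at `a`. In the induction,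
multiplying by `b` leaves the surplus `(s + 1) * a ^ s * (b - a) ^ 2`. -/
theorem pow_add_mul_sub_le_pow {a b : ℝ} (ha : 0 ≤ a) (hb : 0 ≤ b) (s : ℕ) :
    a ^ (s + 1) + (s + 1) * a ^ s * (b - a) ≤ b ^ (s + 1) := by
  induction s with
  | zero => simp
  | succ s ih =>
    have h1 := mul_le_mul_of_nonneg_left ih hb
    have h2 : 0 ≤ a ^ s * (b - a) ^ 2 * (s + 1) := by positivity
    push_cast
    calc _ = b * (a ^ (s + 1) + (s + 1) * a ^ s * (b - a)) - a ^ s * (b - a) ^ 2 * (s + 1) := by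
          ring
      _ ≤ b * b ^ (s + 1) := by linarith
      _ = _ := by ring

/-- The expectation of a product over a sample without replacement is at most that for a sample
with replacement (an instance of Maclaurin's inequality). -/
theorem selectionSample_expect_prod_le (y : Fin n → ℝ) (hy : ∀ j, 0 ≤ y j) (l : List (Fin n))
    (s : ℕ) (hs : s ≤ l.length) :
    (selectionSample l s).expect (fun S => ENNReal.ofReal (S.map y).prod) ≤
      ENNReal.ofReal (((l.map y).sum / l.length) ^ s) := by
  induction l generalizing s with
  | nil =>
    simp only [List.length_nil, nonpos_iff_eq_zero] at hs
    simp [selectionSample, RComp.expect_pure, hs]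
  | cons j l ih =>
    rw [selectionSample]
    simp only [RComp.expect_bind, RComp.expect_step, RComp.expect_randStep]
    set N := l.length with hN
    set a : ℝ := (l.map y).sum / N with ha
    have ha0 : 0 ≤ a := by
      refine div_nonneg (List.sum_nonneg ?_) (by positivity)
      simp only [List.mem_map]
      rintro _ ⟨k, _, rfl⟩
      exact hy k
    -- For empty `l` the mean `a` is `0 / 0 = 0`, and the identity still holds.
    have hsum : (l.map y).sum = N * a := by
      rcases Nat.eq_zero_or_pos N with h0 | h0
      · have : l = [] := List.length_eq_zero_iff.1 h0
        simp [this, h0]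
      · rw [ha]; field_simp
    have hN1 : (0 : ℝ) < (N : ℝ) + 1 := by positivity
    have hterm : ∀ i : Fin (N + 1),
        ((if decide (i.val < s) = true then do
              let s' ← RComp.step (s - 1)
              let S ← selectionSample l s'
              RComp.step (j :: S)
            else selectionSample l s).expect fun S => ENNReal.ofReal (S.map y).prod) ≤
          (if i.val < s then ENNReal.ofReal (y j * a ^ (s - 1)) else 0) +
          (if i.val < s then 0 else ENNReal.ofReal (a ^ s)) := by
      intro i
      by_cases hi : i.val < s
      · simp only [hi, decide_true, if_true, RComp.expect_bind, RComp.expect_step, List.map_cons,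
          List.prod_cons, ENNReal.ofReal_mul (hy j), add_zero]
        rw [RComp.expect_const_mul]
        refine mul_le_mul_right (ih (s - 1) ?_) _
        simp only [List.length_cons] at hs
        omega
      · simp only [hi, decide_false, if_false, zero_add]
        exact ih s (by omega)
    refine (mul_le_mul_right (Finset.sum_le_sum fun i _ => hterm i) _).trans ?_
    rw [Finset.sum_add_distrib, sum_lt N s hs, sum_ge]
    have hcoe : ∀ k : ℕ, (k : ℝ≥0∞) = ENNReal.ofReal k := fun k => (ENNReal.ofReal_natCast k).symm
    rw [hcoe, hcoe, hcoe, ← ENNReal.ofReal_inv_of_pos (by positivity),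
      ← ENNReal.ofReal_mul (by positivity), ← ENNReal.ofReal_mul (by positivity),
      ← ENNReal.ofReal_add (by have := hy j; positivity) (by positivity),
      ← ENNReal.ofReal_mul (by positivity)]
    refine ENNReal.ofReal_le_ofReal ?_
    simp only [List.map_cons, List.sum_cons, List.length_cons, hsum]
    rw [Nat.cast_sub (show s ≤ N + 1 from hs), ← hN]
    cases s with
    | zero =>
      simp only [Nat.cast_zero, zero_mul, pow_zero, zero_add, sub_zero, mul_one]
      push_cast
      rw [inv_mul_cancel₀ hN1.ne']
    | succ s =>
      -- With `b` the mean over `j :: l`, one has `b - a = (y j - a) / (N + 1)`. The average of the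
      -- two branches is therefore exactly the tangent line at `a`, evaluated at `b`.
      have hb : 0 ≤ (y j + N * a) / (N + 1) := by have := hy j; positivity
      have := pow_add_mul_sub_le_pow ha0 hb s
      push_cast
      refine le_trans (le_of_eq ?_) this
      field_simp
      ring

/-- A Chernoff bound for the sum of `w` over a sample without replacement. -/
theorem selectionSample_chernoff (hn : 0 < n) (s : ℕ) (hs : s ≤ n) (w : Fin n → ℝ)
    (hw0 : ∀ j, 0 ≤ w j) (hw1 : ∀ j, w j ≤ 1) (t g T : ℝ)
    -- The sign of `t` is free: positive `t` gives the upper tail and negative `t` the lower one.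
    -- The linear bound with slope `g` makes the mean of `exp (t * w j)` depend on `∑ j, w j` only.
    (hg : ∀ x : ℝ, 0 ≤ x → x ≤ 1 → Real.exp (t * x) ≤ 1 + g * x) :
    (selectionSample (List.finRange n) s).prob (fun S => t * T ≤ t * (S.map w).sum) ≤
      ENNReal.ofReal (Real.exp (g * (s / n * ∑ j, w j) - t * T)) := by
  have hprod : ∀ S : List (Fin n), (S.map fun j => Real.exp (t * w j)).prod =
      Real.exp (t * (S.map w).sum) := by
    intro S
    induction S with
    | nil => simp
    | cons j S ih => simp [ih, mul_add, Real.exp_add]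
  rw [RComp.prob_eq_expect]
  calc _ ≤ (selectionSample (List.finRange n) s).expect (fun S =>
        ENNReal.ofReal (Real.exp (-(t * T))) *
          ENNReal.ofReal (S.map fun j => Real.exp (t * w j)).prod) := by
        refine RComp.expect_mono _ fun S => ?_
        rw [← ENNReal.ofReal_mul (Real.exp_pos _).le, hprod, ← Real.exp_add]
        by_cases hS : t * T ≤ t * (S.map w).sum
        · simp only [Set.indicator, Set.mem_ofPred_eq, hS, if_true, Pi.one_apply]
          rw [← ENNReal.ofReal_one]
          exact ENNReal.ofReal_le_ofReal (Real.one_le_exp (by linarith))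
        · simp [Set.indicator, hS]
    _ ≤ _ := by
        rw [RComp.expect_const_mul]
        have hE := selectionSample_expect_prod_le (fun j => Real.exp (t * w j))
          (fun j => (Real.exp_pos _).le) (List.finRange n) s (by simpa using hs)
        refine (mul_le_mul' le_rfl hE).trans ?_
        rw [← ENNReal.ofReal_mul (Real.exp_pos _).le]
        refine ENNReal.ofReal_le_ofReal ?_
        have hn' : (0 : ℝ) < n := by exact_mod_cast hn
        have hmean : ((List.finRange n).map fun j => Real.exp (t * w j)).sum /
            ((List.finRange n).length : ℝ) ≤ Real.exp (g * (∑ j, w j) / n) := by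
          rw [← Fin.sum_univ_def, List.length_finRange]
          calc _ ≤ (∑ j : Fin n, (1 + g * w j)) / n := by
                gcongr with j
                exact hg _ (hw0 j) (hw1 j)
            _ = g * (∑ j, w j) / n + 1 := by
                rw [Finset.sum_add_distrib, ← Finset.mul_sum]
                simp
                field_simp
                ring
            _ ≤ _ := Real.add_one_le_exp _
        have h0 : 0 ≤ ((List.finRange n).map fun j => Real.exp (t * w j)).sum /
            ((List.finRange n).length : ℝ) := by
          rw [← Fin.sum_univ_def]
          positivity
        calc _ ≤ Real.exp (-(t * T)) * Real.exp (g * (∑ j, w j) / n) ^ s := by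
              gcongr
          _ = _ := by
              rw [← Real.exp_nat_mul, ← Real.exp_add]
              congr 1
              ring

theorem exp_neg_le_quadratic {x : ℝ} (hx : 0 ≤ x) : Real.exp (-x) ≤ 1 - x + x ^ 2 / 2 := by
  have h1 := Real.quadratic_le_exp_of_nonneg hx
  have h2 : 0 < 1 - x + x ^ 2 / 2 := by nlinarith [sq_nonneg (x - 1)]
  rw [Real.exp_neg, inv_le_comm₀ (Real.exp_pos _) h2]
  refine le_trans ?_ h1
  rw [inv_le_iff_one_le_mul₀ h2]
  -- The product of `1 - x + x²/2` and `1 + x + x²/2` is `1 + x⁴/4`.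
  nlinarith [sq_nonneg (x ^ 2)]

/-- If the total weight exceeds `B`, the sample is unlikely to have weight at most
`(1 - ε) * (s / n) * B`. -/
theorem selectionSample_lower_tail (hn : 0 < n) (s : ℕ) (hs : s ≤ n) (w : Fin n → ℝ)
    (hw0 : ∀ j, 0 ≤ w j) (hw1 : ∀ j, w j ≤ 1) {ε B : ℝ} (hε0 : 0 ≤ ε) (hε1 : ε ≤ 1)
    (hW : B ≤ ∑ j, w j) :
    (selectionSample (List.finRange n) s).prob
        (fun S => (S.map w).sum ≤ (1 - ε) * (s / n) * B) ≤
      ENNReal.ofReal (Real.exp (-(ε ^ 2 * (s / n * B) / 2))) := by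
  have h := selectionSample_chernoff hn s hs w hw0 hw1 (-ε) (-ε + ε ^ 2 / 2)
    ((1 - ε) * (s / n) * B) (fun x hx0 hx1 => by
      have := exp_neg_le_quadratic (mul_nonneg hε0 hx0)
      rw [neg_mul]
      refine this.trans ?_
      nlinarith [mul_nonneg (sq_nonneg ε) (mul_nonneg hx0 (sub_nonneg.2 hx1))])
  refine (prob_mono _ fun S hS => ?_).trans (h.trans (ENNReal.ofReal_le_ofReal ?_))
  · exact mul_le_mul_of_nonpos_left hS (by linarith)
  · refine Real.exp_le_exp.2 ?_
    have h1 : (s : ℝ) / n * B ≤ s / n * ∑ j, w j := by gcongr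
    have h2 : 0 ≤ ε - ε ^ 2 / 2 := by nlinarith
    -- The coefficients of `s / n * B` add up to `(-ε + ε²/2) + ε (1 - ε) = -ε²/2`.
    nlinarith [mul_le_mul_of_nonneg_left h1 h2]

/-- If the total weight is below `W`, the sample is unlikely to have weight at least `T`. -/
theorem selectionSample_upper_tail (hn : 0 < n) (s : ℕ) (hs : s ≤ n) (w : Fin n → ℝ)
    (hw0 : ∀ j, 0 ≤ w j) (hw1 : ∀ j, w j ≤ 1) {ε W T : ℝ} (hε0 : 0 ≤ ε) (hε1 : ε ≤ 1)
    (hW : ∑ j, w j ≤ W) :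
    (selectionSample (List.finRange n) s).prob (fun S => T ≤ (S.map w).sum) ≤
      ENNReal.ofReal (Real.exp ((ε + ε ^ 2) * (s / n * W) - ε * T)) := by
  have h := selectionSample_chernoff hn s hs w hw0 hw1 ε (ε + ε ^ 2) T (fun x hx0 hx1 => by
      have h1 : |ε * x| ≤ 1 := by
        rw [abs_of_nonneg (by positivity)]; nlinarith
      have := (abs_le.1 (Real.abs_exp_sub_one_sub_id_le h1)).2
      nlinarith [mul_nonneg (sq_nonneg ε) (mul_nonneg hx0 (sub_nonneg.2 hx1))])
  refine (prob_mono _ fun S hS => ?_).trans (h.trans (ENNReal.ofReal_le_ofReal ?_))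
  · exact mul_le_mul_of_nonneg_left hS hε0
  · gcongr

/-! ## Counting threshold patterns -/

/-- The columns whose price under `phi` is smaller than their objective coefficient. -/
noncomputable def LP.cheap (L : LP m n) (phi : Fin m → ℝ) : Finset (Fin n) :=
  Finset.univ.filter fun j => ∑ i, L.a i j * phi i < L.c j

theorem LP.mem_cheap {L : LP m n} {phi : Fin m → ℝ} {j : Fin n} :
    j ∈ L.cheap phi ↔ ∑ i, L.a i j * phi i < L.c j := by
  simp [LP.cheap]

open Classical in
/-- The sets of the form `L.cheap phi`. -/
noncomputable def LP.patterns (L : LP m n) : Finset (Finset (Fin n)) :=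
  Finset.univ.filter fun X => ∃ phi, X = L.cheap phi

theorem LP.mem_patterns {L : LP m n} {X : Finset (Fin n)} :
    X ∈ L.patterns ↔ ∃ phi, X = L.cheap phi := by
  simp [LP.patterns]

/-- More than `m` columns satisfy a linear relation with coefficients `g`, so the `g`-weighted sum
of the reduced costs `c j - ∑ i, a i j * phi i` does not depend on `phi`. Shattering provides prices
whose cheap columns in `T` are exactly those with `g j > 0`, making all terms nonnegative, and
others for `g j < 0`, making all terms nonpositive. A nonzero `g j₀` makes one of the two sums
strict, a contradiction. -/
theorem LP.card_le_of_shatters_patterns (L : LP m n) (T : Finset (Fin n))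
    (hT : L.patterns.Shatters T) : T.card ≤ m := by
  by_contra hlt
  have hdep : ¬ LinearIndependent ℝ (fun j : T => fun i => L.a i j) := by
    intro h
    have := h.fintype_card_le_finrank
    simp at this
    omega
  obtain ⟨g, hg, j₀, hj₀⟩ := Fintype.not_linearIndependent_iff.1 hdep
  have hsum : ∀ phi : Fin m → ℝ,
      ∑ j : T, g j * (L.c j - ∑ i, L.a i j * phi i) = ∑ j : T, g j * L.c j := by
    intro phi
    have : ∑ j : T, g j * ∑ i, L.a i j * phi i = 0 := by
      simp only [Finset.mul_sum]
      rw [Finset.sum_comm]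
      refine Finset.sum_eq_zero fun i _ => ?_
      have := congrFun hg i
      simp only [Finset.sum_apply, Pi.smul_apply, smul_eq_mul, Pi.zero_apply] at this
      calc _ = (∑ j : T, g j * L.a i j) * phi i := by
            rw [Finset.sum_mul]
            exact Finset.sum_congr rfl fun j _ => by ring
        _ = 0 := by rw [this, zero_mul]
    simp only [mul_sub, Finset.sum_sub_distrib, this, sub_zero]
  have hpat : ∀ P : T → Prop, ∃ phi : Fin m → ℝ, ∀ j : T,
      (∑ i, L.a i j * phi i < L.c j ↔ P j) := by
    classical
    intro P
    obtain ⟨X, hX, hTX⟩ := hT (t := (Finset.univ.filter P).map (Function.Embedding.subtype _))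
      (by intro j; simp; tauto)
    obtain ⟨phi, rfl⟩ := LP.mem_patterns.1 hX
    refine ⟨phi, fun j => ?_⟩
    have := Finset.ext_iff.1 hTX j
    simp only [Finset.mem_inter, j.2, true_and, LP.mem_cheap] at this
    rw [this]
    simp
  obtain ⟨phi, hphi⟩ := hpat fun j => 0 < g j
  obtain ⟨phi', hphi'⟩ := hpat fun j => g j < 0
  have hpos : ∀ j : T, 0 ≤ g j * (L.c j - ∑ i, L.a i j * phi i) := by
    intro j
    rcases lt_or_ge 0 (g j) with h | h
    · exact mul_nonneg h.le (sub_nonneg.2 ((hphi j).2 h).le)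
    · refine mul_nonneg_of_nonpos_of_nonpos h (sub_nonpos.2 (not_lt.1 fun h' => ?_))
      exact absurd ((hphi j).1 h') (not_lt.2 h)
  have hneg : ∀ j : T, g j * (L.c j - ∑ i, L.a i j * phi' i) ≤ 0 := by
    intro j
    rcases lt_or_ge (g j) 0 with h | h
    · exact mul_nonpos_of_nonpos_of_nonneg h.le (sub_nonneg.2 ((hphi' j).2 h).le)
    · refine mul_nonpos_of_nonneg_of_nonpos h (sub_nonpos.2 (not_lt.1 fun h' => ?_))
      exact absurd ((hphi' j).1 h') (not_lt.2 h)
  have h1 := Finset.sum_nonneg fun j (_ : j ∈ Finset.univ) => hpos j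
  have h2 := Finset.sum_nonpos fun j (_ : j ∈ Finset.univ) => hneg j
  rw [hsum] at h1 h2
  rcases lt_or_gt_of_ne hj₀ with h | h
  · have : ∑ j : T, g j * (L.c j - ∑ i, L.a i j * phi' i) < 0 :=
      Finset.sum_neg' (fun j _ => hneg j)
        ⟨j₀, Finset.mem_univ _, mul_neg_of_neg_of_pos h (sub_pos.2 ((hphi' j₀).2 h))⟩
    rw [hsum] at this
    linarith
  · have : 0 < ∑ j : T, g j * (L.c j - ∑ i, L.a i j * phi i) :=
      Finset.sum_pos' (fun j _ => hpos j)
        ⟨j₀, Finset.mem_univ _, mul_pos h (sub_pos.2 ((hphi j₀).2 h))⟩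
    rw [hsum] at this
    linarith

/-- Sauer–Shelah with VC dimension at most `m`; `2 ≤ n` lets the geometric sum of `n ^ k` for `k ≤
m` be absorbed into `n ^ (m + 1)`. -/
theorem LP.card_patterns_le (L : LP m n) (hn : 2 ≤ n) : L.patterns.card ≤ n ^ (m + 1) := by
  have hvc : L.patterns.vcDim ≤ m := by
    refine Finset.sup_le fun T hT => ?_
    exact L.card_le_of_shatters_patterns T (Finset.mem_shatterer.1 hT)
  calc L.patterns.card ≤ L.patterns.shatterer.card := Finset.card_le_card_shatterer _
    _ ≤ ∑ k ∈ Finset.Iic L.patterns.vcDim, (Fintype.card (Fin n)).choose k :=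
        Finset.card_shatterer_le_sum_vcDim
    _ ≤ ∑ k ∈ Finset.range (m + 1), n ^ k := by
        rw [Fintype.card_fin]
        refine (Finset.sum_le_sum fun k _ => Nat.choose_le_pow n k).trans
          (Finset.sum_le_sum_of_subset fun k hk => ?_)
        simp only [Finset.mem_Iic, Finset.mem_range] at *
        omega
    _ ≤ n ^ (m + 1) := (Nat.geomSum_lt hn fun k hk => Finset.mem_range.1 hk).le

/-! ## Deterministic computations and step counts -/

/-- The computation with certain result `a` and certain step count `k`. -/
noncomputable def RComp.det (a : α) (k : ℕ) : RComp α := ⟨PMF.pure (a, k)⟩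

theorem RComp.det_bind (a : α) (k : ℕ) (q : α → RComp β) (b : β) (l : ℕ)
    (h : q a = RComp.det b l) : (RComp.det a k >>= q) = RComp.det b (k + l) := by
  simp only [bind, RComp.bind, RComp.det, PMF.pure_bind, h, PMF.pure_map]

theorem RComp.step_bind (a : α) (q : α → RComp β) (b : β) (l : ℕ)
    (h : q a = RComp.det b l) : (RComp.step a >>= q) = RComp.det b (1 + l) :=
  RComp.det_bind a 1 q b l h

theorem RComp.fill_det {k : ℕ} (entry : Fin k → RComp α) (v : Fin k → α) (t : ℕ)
    (h : ∀ i, entry i = RComp.det (v i) t) :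
    RComp.fill entry = RComp.det v (k * (t + 1)) := by
  induction k with
  | zero =>
    rw [RComp.fill, zero_mul, Subsingleton.elim v Fin.elim0]
    rfl
  | succ k ih =>
    rw [RComp.fill, h 0, RComp.det_bind _ _ _ v (1 + (k * (t + 1) + 0))]
    · congr 1; ring
    · refine RComp.step_bind _ _ _ _ ?_
      rw [ih (fun i => entry i.succ) (fun i => v i.succ) fun i => h i.succ]
      refine RComp.det_bind _ _ _ _ _ ?_
      rw [show Fin.cons (v 0) (fun i : Fin k => v i.succ) = v from Fin.cons_self_tail v]
      rfl

/-- The sample LP on the columns listed in `S`. -/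
noncomputable def sampleLP (α εs ε : ℝ) (L : LP m n) (S : List (Fin n)) : LP m S.length :=
  ⟨fun i k => L.a i (S.get k), fun i => (1 - ε) * εs / α * L.b i, fun k => L.c (S.get k)⟩

theorem buildSampleLP_eq (α εs ε : ℝ) (L : LP m n) (S : List (Fin n)) :
    buildSampleLP α εs ε L S =
      RComp.det (sampleLP α εs ε L S) (3 * m * S.length + m + 3 + 3 * m + 3 * S.length) := by
  rw [buildSampleLP, RComp.fill_det _ (fun i k => L.a i (S.get k)) (S.length * (2 + 1)),
    RComp.det_bind _ _ _ (sampleLP α εs ε L S)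
      (1 + (1 + (1 + (m * (2 + 1) + (S.length * (2 + 1) + 0)))))]
  · congr 1; ring
  · refine RComp.step_bind _ _ _ _ (RComp.step_bind _ _ _ _ (RComp.step_bind _ _ _ _ ?_))
    rw [RComp.fill_det _ (fun i => (1 - ε) * εs / α * L.b i) 2]
    · refine RComp.det_bind _ _ _ _ _ ?_
      rw [RComp.fill_det _ (fun k => L.c (S.get k)) 2]
      · exact RComp.det_bind _ _ _ _ _ rfl
      · exact fun k => RComp.step_bind _ _ _ 1 rfl
    · exact fun i => RComp.step_bind _ _ _ 1 rfl
  · exact fun i => RComp.fill_det _ _ _ fun k => RComp.step_bind _ _ _ 1 rfl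

theorem columnPrice_eq (L : LP m n) (phi : Fin m → ℝ) (j : Fin n) :
    columnPrice L phi j = RComp.det (∑ i, L.a i j * phi i) (m * 4) := by
  have key : ∀ (l : List (Fin m)) (z : ℝ),
      (l.foldlM (init := z) fun acc i => do
        let u ← RComp.step (L.a i j)
        let v ← RComp.step (phi i)
        let w ← RComp.step (u * v)
        RComp.step (acc + w)) =
      RComp.det (z + (l.map fun i => L.a i j * phi i).sum) (l.length * 4) := by
    intro l
    induction l with
    | nil => intro z; simp; rfl
    | cons i l ih =>
      intro z
      rw [List.foldlM_cons, RComp.step_bind _ _ (z + L.a i j * phi i) 3]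
      · refine (RComp.det_bind (z + L.a i j * phi i) _ _ _ _ (ih (z + L.a i j * phi i))).trans ?_
        simp only [List.map_cons, List.sum_cons, List.length_cons, add_assoc]
        congr 1; ring
      · exact RComp.step_bind _ _ _ 2 (RComp.step_bind _ _ _ 1 rfl)
  rw [columnPrice, key, zero_add, List.length_finRange, ← Fin.sum_univ_def]

open Classical in
/-- The vector computed by the thresholding rule. -/
noncomputable def LP.rounded (L : LP m n) (phi : Fin m → ℝ) (j : Fin n) : ℝ :=
  if ∑ i, L.a i j * phi i < L.c j then 1 else 0

theorem threshold_eq (L : LP m n) (phi : Fin m → ℝ) (j : Fin n) :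
    threshold L phi j = RComp.det (L.rounded phi j) (m * 4 + 2) := by
  rw [threshold, columnPrice_eq, RComp.det_bind _ _ _ (L.rounded phi j) 2]
  refine RComp.step_bind _ _ _ 1 ?_
  unfold LP.rounded RComp.step RComp.det
  congr

theorem RComp.mem_support_step (a : α) (r : α × ℕ) :
    r ∈ (RComp.step a).law.support ↔ r = (a, 1) := by
  simp [RComp.step]

theorem RComp.mem_support_det (a : α) (k : ℕ) (r : α × ℕ) :
    r ∈ (RComp.det a k).law.support ↔ r = (a, k) := by
  simp [RComp.det]

theorem RComp.mem_support_randStep (k : ℕ) (r : Fin (k + 1) × ℕ)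
    (h : r ∈ (RComp.randStep k).law.support) : r.2 = 1 := by
  simp only [RComp.randStep, PMF.mem_support_map_iff] at h
  obtain ⟨_, _, rfl⟩ := h
  rfl

/-- The sublist property makes the sample free of repetitions, and its length fixes the size of the
LP given to the solver. A selected entry costs five steps and a rejected one three. -/
theorem selectionSample_support (l : List (Fin n)) (s : ℕ) (hs : s ≤ l.length)
    (r : List (Fin n) × ℕ) (hr : r ∈ (selectionSample l s).law.support) :
    r.1.Sublist l ∧ r.1.length = s ∧ r.2 ≤ 5 * l.length := by
  induction l generalizing s r with
  | nil =>
    have : r = ([], 0) := by simpa [selectionSample, pure, RComp.pure] using hr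
    simp only [List.length_nil, nonpos_iff_eq_zero] at hs
    simp [this, hs]
  | cons j l ih =>
    rw [selectionSample] at hr
    simp only [RComp.mem_support_bind, RComp.mem_support_step] at hr
    obtain ⟨_, rfl, v, ⟨i, hi, v', ⟨_, rfl, v'', h, rfl⟩, rfl⟩, rfl⟩ := hr
    have hi2 := RComp.mem_support_randStep _ _ hi
    have hi1 := i.1.isLt
    simp only [List.length_cons] at hs ⊢
    by_cases hlt : i.1.val < s
    · simp only [hlt, decide_true, if_true, RComp.mem_support_bind, RComp.mem_support_step] at h
      obtain ⟨_, rfl, w, ⟨w', hw', _, rfl, rfl⟩, rfl⟩ := h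
      obtain ⟨h1, h2, h3⟩ := ih (s - 1) (by omega) w' hw'
      refine ⟨h1.cons_cons j, ?_, ?_⟩
      · simp only [List.length_cons, h2]; omega
      · omega
    · simp only [hlt, decide_false] at h
      obtain ⟨h1, h2, h3⟩ := ih s (by omega) v'' h
      exact ⟨h1.cons j, h2, by omega⟩

/-- The acceleration algorithm after the sampling step. -/
noncomputable def solveAndRound (𝒜 : Solver) (α εs ε : ℝ) (L : LP m n) (S : List (Fin n)) :
    RComp (Fin n → ℝ) := do
  let L' ← buildSampleLP α εs ε L S
  let y ← 𝒜 L'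
  RComp.fill fun j => threshold L y.phi j

theorem accelerate_eq (𝒜 : Solver) (α εs ε : ℝ) (L : LP m n) :
    accelerate 𝒜 α εs ε L = (do
      let t ← RComp.step (εs * n)
      let s ← RComp.step ⌈t⌉₊
      let S ← selectionSample (List.finRange n) s
      solveAndRound 𝒜 α εs ε L S) := rfl

theorem solveAndRound_support (𝒜 : Solver) (α εs ε : ℝ) (L : LP m n) (S : List (Fin n))
    (r : (Fin n → ℝ) × ℕ) (hr : r ∈ (solveAndRound 𝒜 α εs ε L S).law.support) :
    ∃ y ∈ (𝒜 (sampleLP α εs ε L S)).law.support, r = (L.rounded y.1.phi,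
      3 * m * S.length + m + 3 + 3 * m + 3 * S.length + (y.2 + n * (m * 4 + 2 + 1))) := by
  rw [solveAndRound, buildSampleLP_eq] at hr
  simp only [RComp.mem_support_bind, RComp.mem_support_det] at hr
  obtain ⟨_, rfl, v, ⟨y, hy, w, hw, rfl⟩, rfl⟩ := hr
  rw [RComp.fill_det _ (L.rounded y.1.phi) (m * 4 + 2) (fun j => threshold_eq L y.1.phi j),
    RComp.mem_support_det] at hw
  subst hw
  exact ⟨y, hy, rfl⟩

theorem accelerate_stepsLE (𝒜 : Solver) (α εs ε : ℝ) (L : LP m n) (s T : ℕ) (hm : 0 < m)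
    (hn : 0 < n) (hsn : s ≤ n) (hs : εs * n = s)
    (hT : ∀ S : List (Fin n), S.length = s → (𝒜 (sampleLP α εs ε L S)).StepsLE T) :
    (accelerate 𝒜 α εs ε L).StepsLE (T + 30 * m * n) := by
  intro r hr
  rw [accelerate_eq] at hr
  simp only [RComp.mem_support_bind, RComp.mem_support_step] at hr
  obtain ⟨_, rfl, v, ⟨_, rfl, w, ⟨S, hS, z, hz, rfl⟩, rfl⟩, rfl⟩ := hr
  simp only [hs, Nat.ceil_natCast] at hS
  obtain ⟨-, h2, h3⟩ := selectionSample_support _ s (by simpa using hsn) S hS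
  obtain ⟨y, hy, rfl⟩ := solveAndRound_support 𝒜 α εs ε L S.1 z hz
  have := hT S.1 h2 y hy
  simp only [List.length_finRange] at h3
  have hle : S.1.length ≤ n := h2.trans_le hsn
  have a1 : m * S.1.length ≤ m * n := Nat.mul_le_mul_left _ hle
  have a2 : n ≤ m * n := Nat.le_mul_of_pos_left _ hm
  have a3 : m ≤ m * n := Nat.le_mul_of_pos_right _ hn
  have e1 : 3 * m * S.1.length = 3 * (m * S.1.length) := by ring
  have e2 : n * (m * 4 + 2 + 1) = 4 * (m * n) + 3 * n := by ring
  have e3 : 30 * m * n = 30 * (m * n) := by ring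
  simp only [e1, e2, e3]
  -- Bounding each of `1`, `m`, `n` and `m * S.1.length` by `m * n` gives a total of `27 * (m * n)`
  -- besides the solver's steps.
  omega

/-! ## Approximate complementary slackness on the sample -/

/-- The coefficient of column `j` in row `i` if `j` belongs to `X`, and `0` otherwise. -/
noncomputable def LP.weight (L : LP m n) (X : Finset (Fin n)) (i : Fin m) (j : Fin n) : ℝ :=
  if j ∈ X then L.a i j else 0

theorem LP.weight_cheap (L : LP m n) (phi : Fin m → ℝ) (i : Fin m) (j : Fin n) :
    L.weight (L.cheap phi) i j = L.a i j * L.rounded phi j := by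
  by_cases h : ∑ i, L.a i j * phi i < L.c j <;> simp [LP.weight, LP.rounded, LP.mem_cheap, h]

theorem LP.IsPacking.weight_nonneg {L : LP m n} (hL : L.IsPacking) (X : Finset (Fin n))
    (i : Fin m) (j : Fin n) : 0 ≤ L.weight X i j := by
  unfold LP.weight
  split_ifs
  exacts [hL.a_nonneg i j, le_rfl]

theorem LP.IsPacking.weight_le_one {L : LP m n} (hL : L.IsPacking) (X : Finset (Fin n))
    (i : Fin m) (j : Fin n) : L.weight X i j ≤ 1 := by
  unfold LP.weight
  split_ifs
  exacts [hL.a_le_one i j, zero_le_one]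

theorem LP.rounded_nonneg (L : LP m n) (phi : Fin m → ℝ) (j : Fin n) : 0 ≤ L.rounded phi j := by
  unfold LP.rounded
  split_ifs <;> norm_num

theorem LP.rounded_le_one (L : LP m n) (phi : Fin m → ℝ) (j : Fin n) : L.rounded phi j ≤ 1 := by
  unfold LP.rounded
  split_ifs <;> norm_num

theorem sum_map_eq_sum_get (S : List (Fin n)) (w : Fin n → ℝ) :
    (S.map w).sum = ∑ k : Fin S.length, w (S.get k) := by
  simp

theorem LP.IsPacking.sampleLP {L : LP m n} (hL : L.IsPacking) {α εs ε : ℝ} (hα : 0 ≤ α)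
    (hεs : 0 ≤ εs) (hε : ε ≤ 1) (S : List (Fin n)) : (sampleLP α εs ε L S).IsPacking where
  a_nonneg i k := hL.a_nonneg i (S.get k)
  a_le_one i k := hL.a_le_one i (S.get k)
  b_nonneg i := mul_nonneg (div_nonneg (mul_nonneg (sub_nonneg.2 hε) hεs) hα) (hL.b_nonneg i)
  c_nonneg k := hL.c_nonneg (S.get k)

/-- Dual feasibility forces `psi > 0` on a cheap column, so there `1 ≤ α * x`. The resulting loss
`α` cancels the `α` by which the right-hand side of the sample LP was scaled down. -/
theorem LP.ApproxSlack.sample_weight_le {L : LP m n} (hL : L.IsPacking) {α εs ε : ℝ} (hα : 1 ≤ α)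
    {S : List (Fin n)} {y : PrimalDual m S.length}
    (hy : (sampleLP α εs ε L S).ApproxSlack 1 α y) (i : Fin m) :
    (S.map (L.weight (L.cheap y.phi) i)).sum ≤ (1 - ε) * εs * L.b i := by
  have hα0 : 0 < α := by linarith
  have hrow := hy.primal_feasible.row_le i
  rw [sum_map_eq_sum_get]
  calc _ ≤ ∑ k : Fin S.length, α * (L.a i (S.get k) * y.x k) := by
        refine Finset.sum_le_sum fun k _ => ?_
        have ha := hL.a_nonneg i (S.get k)
        have hx := hy.primal_feasible.nonneg k
        rw [LP.weight]
        split_ifs with hc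
        · rw [LP.mem_cheap] at hc
          have hcol := hy.dual_feasible.col_ge k
          simp only [PackingAccel.sampleLP] at hcol
          have hx := (hy.dual_slack_box k (by linarith)).1
          rw [div_le_iff₀ hα0] at hx
          nlinarith
        · positivity
    _ = α * ∑ k : Fin S.length, L.a i (S.get k) * y.x k := (Finset.mul_sum _ _ _).symm
    _ ≤ α * ((1 - ε) * εs / α * L.b i) := mul_le_mul_of_nonneg_left hrow hα0.le
    _ = _ := by field_simp

theorem LP.GeneralPosition.sum_map_tie_le {L : LP m n} (hgp : L.GeneralPosition)
    {phi : Fin m → ℝ} (hphi : ∀ i, 0 ≤ phi i) [DecidablePred fun j => ∑ i, L.a i j * phi i = L.c j]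
    {S : List (Fin n)} (hS : S.Nodup) :
    (S.map fun j => if ∑ i, L.a i j * phi i = L.c j then (1 : ℝ) else 0).sum ≤ m := by
  have hcard := hgp phi hphi
  rw [Set.ncard_eq_toFinset_card'] at hcard
  rw [← List.sum_toFinset _ hS]
  calc _ ≤ ∑ j : Fin n, if ∑ i, L.a i j * phi i = L.c j then (1 : ℝ) else 0 :=
        Finset.sum_le_sum_of_subset_of_nonneg (Finset.subset_univ _) fun j _ _ => by
          split_ifs <;> norm_num
    _ ≤ m := by
        rw [Finset.sum_boole]
        refine Nat.cast_le.2 (le_trans (le_of_eq ?_) hcard)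
        congr 1
        ext j
        simp

/-- Exact primal slackness puts every column with `x > 0` among the cheap ones or the ties. The at
most `m` ties account for at most `m` units of load, since `a ≤ 1` and `x ≤ 1`. One factor `α` comes
from the scaled right-hand side, the other from dual slackness of the row. -/
theorem LP.ApproxSlack.le_sample_weight {L : LP m n} (hL : L.IsPacking)
    (hgp : L.GeneralPosition) {α εs ε : ℝ} {S : List (Fin n)} (hS : S.Nodup)
    {y : PrimalDual m S.length} (hy : (sampleLP α εs ε L S).ApproxSlack 1 α y) {i : Fin m}
    (hi : 0 < y.phi i) :
    (1 - ε) * εs * L.b i / α ^ 2 - m ≤ (S.map (L.weight (L.cheap y.phi) i)).sum := by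
  classical
  have htie := hgp.sum_map_tie_le hy.dual_feasible.phi_nonneg hS
  have hrow := (hy.dual_slack_row i hi).1
  rw [sum_map_eq_sum_get] at htie ⊢
  have hterm : ∑ k : Fin S.length, L.a i (S.get k) * y.x k ≤
      ∑ k : Fin S.length, (L.weight (L.cheap y.phi) i (S.get k) +
        if ∑ i, L.a i (S.get k) * y.phi i = L.c (S.get k) then (1 : ℝ) else 0) := by
    refine Finset.sum_le_sum fun k _ => ?_
    have ha := hL.a_nonneg i (S.get k)
    have ha1 := hL.a_le_one i (S.get k)
    have hx := hy.primal_feasible.nonneg k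
    have hx1 := hy.primal_feasible.le_one k
    rcases hx.eq_or_lt with h0 | h0
    · rw [← h0, mul_zero]
      refine add_nonneg (hL.weight_nonneg _ _ _) ?_
      split_ifs <;> norm_num
    · have h1 := (hy.primal_slack k h0).2
      simp only [PackingAccel.sampleLP, one_mul] at h1
      have h2 := hy.dual_feasible.psi_nonneg k
      have h3 : ∑ i, L.a i (S.get k) * y.phi i ≤ L.c (S.get k) := by linarith
      rcases h3.eq_or_lt with h3 | h3
      · rw [if_pos h3]
        have := hL.weight_nonneg (L.cheap y.phi) i (S.get k)
        nlinarith
      · rw [if_neg h3.ne, LP.weight, if_pos (LP.mem_cheap.2 h3)]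
        nlinarith
  rw [Finset.sum_add_distrib] at hterm
  have hrow' : (1 - ε) * εs / α * L.b i / α ≤ ∑ k : Fin S.length, L.a i (S.get k) * y.x k := hrow
  have heq : (1 - ε) * εs * L.b i / α ^ 2 = (1 - ε) * εs / α * L.b i / α := by
    rw [pow_two, ← div_div]
    ring
  rw [heq]
  linarith

/-! ### From row loads on all columns to feasibility and value of the rounded vector -/

theorem LP.rounded_feasible {L : LP m n} (phi : Fin m → ℝ)
    (h : ∀ i, ∑ j, L.weight (L.cheap phi) i j ≤ L.b i) : L.Feasible (L.rounded phi) where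
  nonneg := L.rounded_nonneg phi
  le_one := L.rounded_le_one phi
  row_le i := by simpa only [LP.weight_cheap] using h i

/-- Weak duality: rounding at prices `phi` is nearly optimal if the rows with positive price are
nearly saturated. -/
theorem LP.mul_value_le_value_rounded {L : LP m n} {phi : Fin m → ℝ}
    (hphi : ∀ i, 0 ≤ phi i) {ρ : ℝ} (hρ0 : 0 ≤ ρ) (hρ1 : ρ ≤ 1)
    (h : ∀ i, 0 < phi i → ρ * L.b i ≤ ∑ j, L.weight (L.cheap phi) i j) {z : Fin n → ℝ}
    (hz : L.Feasible z) : ρ * L.value z ≤ L.value (L.rounded phi) := by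
  have hswap : ∀ x : Fin n → ℝ,
      ∑ j, (∑ i, L.a i j * phi i) * x j = ∑ i, phi i * ∑ j, L.a i j * x j := by
    intro x
    simp only [Finset.sum_mul, Finset.mul_sum]
    rw [Finset.sum_comm]
    exact Finset.sum_congr rfl fun i _ => Finset.sum_congr rfl fun j _ => by ring
  -- Lagrangian decomposition: priced row loads plus reduced costs. The rounded vector maximizes the
  -- second part over the box coordinate by coordinate, and near-saturation of the priced rows
  -- controls the first.
  have hsplit : ∀ x : Fin n → ℝ, L.value x =
      ∑ i, phi i * ∑ j, L.a i j * x j + ∑ j, (L.c j - ∑ i, L.a i j * phi i) * x j := by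
    intro x
    rw [← hswap, ← Finset.sum_add_distrib]
    exact Finset.sum_congr rfl fun j _ => by ring
  have hgain : ∑ j, (L.c j - ∑ i, L.a i j * phi i) * z j ≤
      ∑ j, (L.c j - ∑ i, L.a i j * phi i) * L.rounded phi j := by
    refine Finset.sum_le_sum fun j _ => ?_
    have h0 := hz.nonneg j
    have h1 := hz.le_one j
    unfold LP.rounded
    split_ifs with hc <;> nlinarith
  -- Nonnegativity is what allows the factor `ρ ≤ 1` to be dropped from the reduced-cost part.
  have hgain0 : 0 ≤ ∑ j, (L.c j - ∑ i, L.a i j * phi i) * L.rounded phi j := by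
    refine Finset.sum_nonneg fun j _ => ?_
    unfold LP.rounded
    split_ifs with hc
    · linarith
    · simp
  have hprice : ρ * ∑ i, phi i * ∑ j, L.a i j * z j ≤
      ∑ i, phi i * ∑ j, L.a i j * L.rounded phi j := by
    rw [Finset.mul_sum]
    refine Finset.sum_le_sum fun i _ => ?_
    rcases (hphi i).eq_or_lt with h0 | h0
    · simp [← h0]
    · have h1 := h i h0
      simp only [LP.weight_cheap] at h1
      have h2 := mul_le_mul_of_nonneg_left (hz.row_le i) hρ0
      have h3 := mul_le_mul_of_nonneg_left (h2.trans h1) h0.le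
      linarith
  rw [hsplit z, hsplit (L.rounded phi), mul_add]
  have := mul_le_mul_of_nonneg_left hgain hρ0
  nlinarith

/-! ## Good samples -/

/-- Row `i` is violated by the columns in `X`, but the sample does not show it. -/
def LP.HidesViolation (L : LP m n) (εs ε : ℝ) (X : Finset (Fin n)) (i : Fin m)
    (S : List (Fin n)) : Prop :=
  L.b i < ∑ j, L.weight X i j ∧ (S.map (L.weight X i)).sum ≤ (1 - ε) * εs * L.b i

/-- Row `i` is far from saturated by the columns in `X`, but nearly saturated on the sample. -/
def LP.HidesSlack (L : LP m n) (α εs ε : ℝ) (X : Finset (Fin n)) (i : Fin m)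
    (S : List (Fin n)) : Prop :=
  3 * ε < 1 ∧ ∑ j, L.weight X i j < (1 - 3 * ε) / α ^ 2 * L.b i ∧
    (1 - ε) * εs * L.b i / α ^ 2 - m ≤ (S.map (L.weight X i)).sum

/-- The sample is representative for all threshold patterns and all rows. -/
def LP.GoodSample (L : LP m n) (α εs ε : ℝ) (S : List (Fin n)) : Prop :=
  ∀ p ∈ L.patterns ×ˢ (Finset.univ : Finset (Fin m)),
    ¬(L.HidesViolation εs ε p.1 p.2 S ∨ L.HidesSlack α εs ε p.1 p.2 S)

/-- Goodness covers all patterns at once, so it applies to the pattern of `y.phi` even though `y` is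
computed from `S`. If `3 * ε ≥ 1` the claimed ratio is not positive and the value bound is trivial.
-/
theorem LP.GoodSample.isApproxSolution {L : LP m n} (hL : L.IsPacking) (hgp : L.GeneralPosition)
    {α εs ε : ℝ} (hα : 1 ≤ α) (hε : 0 ≤ ε) {S : List (Fin n)} (hS : S.Nodup)
    (hgood : L.GoodSample α εs ε S) {y : PrimalDual m S.length}
    (hy : (sampleLP α εs ε L S).ApproxSlack 1 α y) :
    L.IsApproxSolution ((1 - 3 * ε) / α ^ 2) (L.rounded y.phi) := by
  have hα2 : 1 ≤ α ^ 2 := one_le_pow₀ hα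
  have hmem : ∀ i, (L.cheap y.phi, i) ∈ L.patterns ×ˢ (Finset.univ : Finset (Fin m)) := fun i =>
    Finset.mem_product.2 ⟨LP.mem_patterns.2 ⟨_, rfl⟩, Finset.mem_univ _⟩
  refine ⟨LP.rounded_feasible _ fun i => ?_, fun z hz => ?_⟩
  · by_contra hlt
    rw [not_le] at hlt
    exact hgood _ (hmem i) (Or.inl ⟨hlt, hy.sample_weight_le hL hα i⟩)
  · have hz0 : 0 ≤ L.value z :=
      Finset.sum_nonneg fun j _ => mul_nonneg (hL.c_nonneg j) (hz.nonneg j)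
    have hr0 : 0 ≤ L.value (L.rounded y.phi) :=
      Finset.sum_nonneg fun j _ => mul_nonneg (hL.c_nonneg j) (L.rounded_nonneg _ j)
    rcases le_or_gt 1 (3 * ε) with h1 | h1
    · exact (mul_nonpos_of_nonpos_of_nonneg
        (div_nonpos_of_nonpos_of_nonneg (by linarith) (by positivity)) hz0).trans hr0
    · refine LP.mul_value_le_value_rounded hy.dual_feasible.phi_nonneg
        (div_nonneg (by linarith) (by positivity)) ?_ (fun i hi => ?_) hz
      · rw [div_le_one (by positivity)]
        linarith
      · by_contra hlt
        rw [not_le] at hlt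
        exact hgood _ (hmem i) (Or.inr ⟨h1, hlt, hy.le_sample_weight hL hgp hS hi⟩)

theorem LP.prob_goodSample {L : LP m n} (hL : L.IsPacking) (hn : 2 ≤ n) {s : ℕ} (hs : s ≤ n)
    {α εs ε : ℝ} (hα : 1 ≤ α) (hα2 : α ^ 2 ≤ 5 / 4) (hε0 : 0 ≤ ε) (hε1 : ε ≤ 1)
    (hεs : εs * n = s)
    (hb : ∀ i, 6 * (m + 2) * Real.log n ≤ ε ^ 2 * (εs * L.b i)) :
    ENNReal.ofReal (1 - 1 / n) ≤
      (selectionSample (List.finRange n) s).prob (L.GoodSample α εs ε) := by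
  have hn0 : 0 < n := by omega
  have hnR : (0 : ℝ) < n := by exact_mod_cast hn0
  have hεs' : εs = s / n := by field_simp; exact hεs
  have hlog : 1 / 2 ≤ Real.log n := by
    have h2 : Real.log 2 ≤ Real.log n := Real.log_le_log (by norm_num) (by exact_mod_cast hn)
    linarith [Real.log_two_gt_d9]
  have hm0 : (0 : ℝ) ≤ m := Nat.cast_nonneg m
  -- `δ = n ^ (-(3 * m + 6))`; the `3` is half of the `6` in `hb`, because the lower tail has
  -- exponent `ε² / 2`.
  obtain ⟨δ, hδ⟩ : ∃ δ, δ = Real.exp (-(3 * (m + 2) * Real.log n)) := ⟨_, rfl⟩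
  have hδ0 : 0 ≤ δ := hδ ▸ (Real.exp_pos _).le
  have hlow : ∀ p : Finset (Fin n) × Fin m, (selectionSample (List.finRange n) s).prob
      (L.HidesViolation εs ε p.1 p.2) ≤ ENNReal.ofReal δ := by
    intro p
    by_cases hW : L.b p.2 < ∑ j, L.weight p.1 p.2 j
    · refine (prob_mono _ fun S hS => hS.2).trans ?_
      rw [hεs']
      refine (selectionSample_lower_tail hn0 s hs _ (hL.weight_nonneg _ _) (hL.weight_le_one _ _)
        hε0 hε1 hW.le).trans (ENNReal.ofReal_le_ofReal (hδ ▸ Real.exp_le_exp.2 ?_))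
      have := hb p.2
      rw [hεs'] at this
      linarith
    · rw [prob_false _ _ fun S hS => hW hS.1]
      exact zero_le
  have hupp : ∀ p : Finset (Fin n) × Fin m, (selectionSample (List.finRange n) s).prob
      (L.HidesSlack α εs ε p.1 p.2) ≤
      ENNReal.ofReal δ := by
    intro p
    by_cases hW : 3 * ε < 1 ∧ ∑ j, L.weight p.1 p.2 j < (1 - 3 * ε) / α ^ 2 * L.b p.2
    · refine (prob_mono _ fun S hS => hS.2.2).trans ?_
      refine (selectionSample_upper_tail hn0 s hs _ (hL.weight_nonneg _ _) (hL.weight_le_one _ _)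
        hε0 hε1 hW.2.le).trans (ENNReal.ofReal_le_ofReal (hδ ▸ Real.exp_le_exp.2 ?_))
      rw [← hεs']
      set M : ℝ := εs * L.b p.2 / α ^ 2 with hM
      have hEM : 6 * (m + 2) * Real.log n ≤ ε ^ 2 * M * (5 / 4) := by
        have h1 : εs * L.b p.2 = M * α ^ 2 := by rw [hM]; field_simp
        have h2 : 0 ≤ M := by
          have := hL.b_nonneg p.2
          have : 0 ≤ εs := by rw [hεs']; positivity
          positivity
        have h3 := hb p.2
        rw [h1] at h3
        nlinarith [mul_le_mul_of_nonneg_left hα2 (mul_nonneg (sq_nonneg ε) h2)]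
      have hM0 : 0 ≤ M := by
        have := hL.b_nonneg p.2
        have : 0 ≤ εs := by rw [hεs']; positivity
        positivity
      -- The gap between `1 - 3ε` and `1 - ε` pays for the `ε²` of the Chernoff slope and leaves
      -- `-ε² M`. By `hEM` this is at most `-(24/5) (m + 2) log n`, and the excess over `3 (m + 2)
      -- log n` absorbs the tie term `ε * m ≤ m / 3`, since `log n ≥ 1/2`.
      have heq : (ε + ε ^ 2) * (εs * ((1 - 3 * ε) / α ^ 2 * L.b p.2)) -
          ε * ((1 - ε) * εs * L.b p.2 / α ^ 2 - m) = -(ε ^ 2 * M) - 3 * ε ^ 3 * M + ε * m := by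
        rw [hM]
        ring
      rw [heq]
      have h4 : 0 ≤ 3 * ε ^ 3 * M := by positivity
      have h5 : ε * m ≤ 1 / 3 * m := by
        refine mul_le_mul_of_nonneg_right ?_ hm0
        linarith [hW.1]
      have h6 : (m + 2 : ℝ) * (1 / 2) ≤ (m + 2) * Real.log n :=
        mul_le_mul_of_nonneg_left hlog (by positivity)
      linarith
    · rw [prob_false _ _ fun S hS => hW ⟨hS.1, hS.2.1⟩]
      exact zero_le
  have hbad : (selectionSample (List.finRange n) s).prob (fun S => ¬L.GoodSample α εs ε S) ≤
      ENNReal.ofReal (1 / n) := by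
    refine (prob_mono _ fun S hS => ?_).trans
      ((RComp.prob_exists_le _ (L.patterns ×ˢ (Finset.univ : Finset (Fin m))) fun p S =>
        L.HidesViolation εs ε p.1 p.2 S ∨ L.HidesSlack α εs ε p.1 p.2 S).trans ?_)
    · simpa only [LP.GoodSample, not_forall, not_not, exists_prop] using hS
    · refine (Finset.sum_le_sum fun p _ => (RComp.prob_or_le _ _ _).trans
        (add_le_add (hlow p) (hupp p))).trans ?_
      rw [Finset.sum_const, Finset.card_product, Finset.card_univ, Fintype.card_fin, nsmul_eq_mul,
        ← ENNReal.ofReal_add hδ0 hδ0,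
        ← ENNReal.ofReal_natCast, ← ENNReal.ofReal_mul (Nat.cast_nonneg _)]
      refine ENNReal.ofReal_le_ofReal ?_
      have hδ' : δ = 1 / (n : ℝ) ^ (3 * m + 6) := by
        rw [hδ, Real.exp_neg, one_div]
        congr 1
        rw [← Real.exp_log (pow_pos hnR (3 * m + 6)), Real.log_pow]
        congr 1
        push_cast
        ring
      -- Union bound over patterns, rows and the two kinds of failure; the last factor `n` is the
      -- target `1 / n`.
      have hcount : L.patterns.card * m * 2 * n ≤ n ^ (3 * m + 6) := by
        calc L.patterns.card * m * 2 * n ≤ n ^ (m + 1) * n ^ m * n * n := by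
              gcongr
              · exact L.card_patterns_le hn
              · exact (Nat.lt_pow_self (by omega)).le
          _ = n ^ (2 * m + 3) := by ring
          _ ≤ n ^ (3 * m + 6) := Nat.pow_le_pow_right hn0 (by omega)
      rw [hδ', ← mul_one (1 / (n : ℝ)), ← two_mul, ← mul_assoc, mul_one_div,
        div_le_iff₀ (by positivity), mul_one, one_div, ← div_eq_inv_mul, le_div_iff₀ hnR]
      exact_mod_cast hcount
  have htot := RComp.prob_add_prob_not (selectionSample (List.finRange n) s)
    (L.GoodSample α εs ε)
  rw [ENNReal.ofReal_sub _ (by positivity), ENNReal.ofReal_one, tsub_le_iff_right, ← htot]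
  gcongr

end PackingAccel

/-! ### The main theorem -/

theorem theorem1 :
    ∃ C : ℕ, ∀ (𝒜 : Solver) (αd : ℝ) (f : ℕ → ℕ → ℕ),
      1 ≤ αd → IsApproxAlgorithm 1 αd 𝒜 → HasRuntime 𝒜 f →
      ∀ (m n s : ℕ) (L : LP m n) (εs εf : ℝ),
        0 < m → 0 < n → L.IsPacking → L.GeneralPosition → 0 < L.minRhs →
        0 < εs → εs ≤ 1 → εs * n = s →
        2 * αd ^ 4 + αd ^ 2 * (εf / 3) ≤ 3 →
        εf ≥ 3 * Real.sqrt (6 * (m + 2) * Real.log n / (εs * L.minRhs)) →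
        (accelerate 𝒜 αd εs (εf / 3) L).StepsLE (f s m + C * m * n) ∧
        ENNReal.ofReal (1 - 1 / n) ≤
          (accelerate 𝒜 αd εs (εf / 3) L).prob
            (L.IsApproxSolution ((1 - εf) / αd ^ 2)) := by
  refine ⟨30, fun 𝒜 αd f hαd hA hf m n s L εs εf hm hn hL hgp hB hεs0 hεs1 hs hα4 hεf => ?_⟩
  have hnR : (0 : ℝ) < n := by exact_mod_cast hn
  have hsn : s ≤ n := by
    have : (s : ℝ) ≤ n := by rw [← hs]; nlinarith
    exact_mod_cast this
  have hα2 : 1 ≤ αd ^ 2 := one_le_pow₀ hαd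
  have hε0 : 0 ≤ εf / 3 :=
    div_nonneg (le_trans (by positivity) hεf) (by norm_num)
  have hα4' : 1 ≤ αd ^ 4 := one_le_pow₀ hαd
  -- The closeness assumption on `αd` enters through two consequences only: `ε ≤ 1`, and `αd ^ 2 ≤ 5
  -- / 4` from `2 * αd ^ 4 ≤ 3`.
  have hε1 : εf / 3 ≤ 1 := by nlinarith
  have hα54 : αd ^ 2 ≤ 5 / 4 := by
    have : 0 ≤ αd ^ 2 * (εf / 3) := by positivity
    have h4 : αd ^ 4 = αd ^ 2 * αd ^ 2 := by ring
    nlinarith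
  refine ⟨?_, ?_⟩
  · refine accelerate_stepsLE 𝒜 αd εs (εf / 3) L s (f s m) hm hn hsn hs fun S hS => ?_
    rw [← hS]
    exact hf m S.length _ (hL.sampleLP (by linarith) hεs0.le hε1 S)
  -- For `n = 1` the required probability is `0`; the pattern count needs `n ≥ 2`.
  · rcases Nat.lt_or_ge n 2 with h1 | h2
    · have : n = 1 := by omega
      subst this
      simp
    · have hb : ∀ i, 6 * (m + 2) * Real.log n ≤ (εf / 3) ^ 2 * (εs * L.b i) := by
        intro i
        have hi : L.minRhs ≤ L.b i := ciInf_le (Set.finite_range L.b).bddBelow i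
        have h3 : Real.sqrt (6 * (m + 2) * Real.log n / (εs * L.minRhs)) ≤ εf / 3 := by linarith
        rw [Real.sqrt_le_left hε0, div_le_iff₀ (mul_pos hεs0 hB)] at h3
        refine h3.trans ?_
        gcongr
      refine (LP.prob_goodSample hL h2 hsn hαd hα54 hε0 hε1 hs hb).trans ?_
      rw [accelerate_eq, prob_step_bind, prob_step_bind, hs, Nat.ceil_natCast]
      -- Once the sample is good, the conclusion holds for every possible answer of the solver, so
      -- its own randomness costs no probability.
      refine RComp.prob_le_prob_bind _ _ _ _ fun S hS hgood r hr => ?_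
      obtain ⟨hsub, -, -⟩ := selectionSample_support _ s (by simpa using hsn) S hS
      obtain ⟨y, hy, rfl⟩ := solveAndRound_support 𝒜 αd εs (εf / 3) L S.1 r hr
      have := hgood.isApproxSolution hL hgp hαd hε0 (hsub.nodup (List.nodup_finRange n))
        (hA m _ _ (hL.sampleLP (by linarith) hεs0.le hε1 S.1) y hy)
      rwa [mul_div_cancel₀ εf (by norm_num : (3 : ℝ) ≠ 0)] at this
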